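/- Let $\mathbb F$ be a finite field, let $m\ge n$, and let $0\ne\mathcal C\le\mathbb F^{n\times m}$ be a (linear) rank-metric code. For $V\le\mathbb F^n$ and $W\le\mathbb F^m$ let $V^\perp$, $W^\perp$ be the orthogonal spaces with respect to the standard dot product, let $\mathcal C(V,\mathrm c)=\{M\in\mathcal C : \operatorname{colsp}(M)\le V\}$ and $\mathcal C(W,\mathrm r)=\{M\in\mathcal C : \operatorname{rowsp}(M)\le W\}$, and set \[ \rho_{\mathrm c}(V)=\frac{\dim\mathcal C-\dim\mathcal C(V^\perp,\mathrm c)}{m},\qquad \rho_{\mathrm r}(W)=\frac{\dim\mathcal C-\dim\mathcal C(W^\perp,\mathrm r)}{n}. \] These are the rank functions of the column and row $q$-polymatroids $\mathcal M_{\mathrm c}(\mathcal C)=(\mathbb F^n,\rho_{\mathrm c})$ and $\mathcal M_{\mathrm r}(\mathcal C)=(\mathbb F^m,\rho_{\mathrm r})$. A flat of a $q$-polymatroid $(E,\rho)$ is a subspace $F\le E$ with $\rho(F+\langle x\rangle)>\rho(F)$ for all $x\in E\setminus F$; let $\mathcal F_{\mathrm c}$, $\mathcal F_{\mathrm r}$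 be the sets of flats of $\mathcal M_{\mathrm c}(\mathcal C)$, $\mathcal M_{\mathrm r}(\mathcal C)$. A subspace $\mathcal A\le\mathbb F^{n\times m}$ is an optimal anticode if $\dim\mathcal A=m\cdot\max\{\operatorname{rk}(M) : M\in\mathcal A\}$. For $1\le i\le\dim\mathcal C$ define the generalized weight \[ a_i(\mathcal C)=\frac1m\min\{\dim\mathcal A : \mathcal A\le\mathbb F^{n\times m}\text{ an optimal anticode},\ \dim(\mathcal C\cap\mathcal A)\ge i\} \] and \begin{align*} b_i^{\mathrm c}(\mathcal C)&=n-\max\{\dim V : V\in\mathcal F_{\mathrm c},\ \rho_{\mathrm c}(V)\le\rho_{\mathrm c}(\mathbb F^n)-i/m\},\\ b_i^{\mathrm r}(\mathcal C)&=m-\max\{\dim W : W\in\mathcal F_{\mathrm r},\ \rho_{\mathrm r}(W)\le\rho_{\mathrm r}(\mathbb F^m)-i/n\}. \end{align*} Then the minimum and the maxima above are taken over nonempty sets, and for all $i=1,\dots,\dim\mathcal C$ \[ a_i(\mathcal C)=\begin{cases} b_i^{\mathrm c}(\mathcal C), & \text{if } m>n,\\ \min\{b_i^{\mathrm c}(\mathcal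 C),\,b_i^{\mathrm r}(\mathcal C)\}, & \text{if } m=n.\end{cases} \] Furthermore, if $m=n$, then $b_1^{\mathrm c}(\mathcal C)=b_1^{\mathrm r}(\mathcal C)$. -/

import Mathlib

/-- `rho` is a `q`-rank function: dimension-bounded, monotone and submodular. -/
structure IsQRankFunction {F E : Type*} [Field F] [AddCommGroup E] [Module F E]
    (rho : Submodule F E → ℚ) : Prop where
  nonneg : ∀ V, 0 ≤ rho V
  le_dim : ∀ V, rho V ≤ (Module.finrank F V : ℚ)
  mono : ∀ V W, V ≤ W → rho V ≤ rho W
  submodular : ∀ V W, rho (V ⊔ W) + rho (V ⊓ W) ≤ rho V + rho W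

/-- A `q`-polymatroid on a finite-dimensional vector space `E` over `F`. -/
structure QPolymatroid (F E : Type*) [Field F] [AddCommGroup E] [Module F E]
    [FiniteDimensional F E] where
  rho : Submodule F E → ℚ
  isQRankFunction : IsQRankFunction rho

namespace QPolymatroid

variable {F E : Type*} [Field F] [AddCommGroup E] [Module F E] [FiniteDimensional F E]

/-- A flat: adding any vector outside `V` strictly increases the rank. -/
def IsFlat (M : QPolymatroid F E) (V : Submodule F E) : Prop :=
  ∀ x : E, x ∉ V → M.rho V < M.rho (V ⊔ Submodule.span F {x})

/-- The dimensions of the flats whose rank is at most the rank of the `q`-polymatroid minus `t`. -/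
def flatDims (M : QPolymatroid F E) (t : ℚ) : Set ℕ :=
  {d | ∃ V : Submodule F E, M.IsFlat V ∧ M.rho V ≤ M.rho ⊤ - t ∧ Module.finrank F V = d}

end QPolymatroid

namespace RankMetric

open Module Matrix

variable {F : Type*} [Field F] {n m : ℕ}

/-- The orthogonal space with respect to the standard dot product. -/
def perp {l : ℕ} (V : Submodule F (Fin l → F)) : Submodule F (Fin l → F) where
  carrier := {w | ∀ v ∈ V, v ⬝ᵥ w = 0}
  zero_mem' := fun v _ => dotProduct_zero v
  add_mem' := fun {a b} ha hb v hv => by rw [dotProduct_add, ha v hv, hb v hv, add_zero]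
  smul_mem' := fun c x hx v hv => by rw [dotProduct_smul, hx v hv, smul_zero]

/-- The column space of a matrix. -/
def colsp (M : Matrix (Fin n) (Fin m) F) : Submodule F (Fin n → F) :=
  Submodule.span F (Set.range M.col)

/-- The row space of a matrix. -/
def rowsp (M : Matrix (Fin n) (Fin m) F) : Submodule F (Fin m → F) :=
  Submodule.span F (Set.range M.row)

theorem colsp_le_iff (M : Matrix (Fin n) (Fin m) F) (V : Submodule F (Fin n → F)) :
    colsp M ≤ V ↔ ∀ j, M.col j ∈ V := by
  rw [colsp, Submodule.span_le, Set.range_subset_iff]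
  rfl

theorem rowsp_le_iff (M : Matrix (Fin n) (Fin m) F) (W : Submodule F (Fin m → F)) :
    rowsp M ≤ W ↔ ∀ i, M.row i ∈ W := by
  rw [rowsp, Submodule.span_le, Set.range_subset_iff]
  rfl

/-- The column shortening `C(V, c)`: the matrices in `C` with column space inside `V`. -/
def shortenCol (C : Submodule F (Matrix (Fin n) (Fin m) F)) (V : Submodule F (Fin n → F)) :
    Submodule F (Matrix (Fin n) (Fin m) F) where
  carrier := {M | M ∈ C ∧ colsp M ≤ V}
  zero_mem' := ⟨C.zero_mem, (colsp_le_iff _ _).2 fun _ => V.zero_mem⟩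
  add_mem' := fun ha hb => ⟨C.add_mem ha.1 hb.1, (colsp_le_iff _ _).2 fun j =>
    V.add_mem ((colsp_le_iff _ _).1 ha.2 j) ((colsp_le_iff _ _).1 hb.2 j)⟩
  smul_mem' := fun c _ hx => ⟨C.smul_mem c hx.1, (colsp_le_iff _ _).2 fun j =>
    V.smul_mem c ((colsp_le_iff _ _).1 hx.2 j)⟩

/-- The row shortening `C(W, r)`: the matrices in `C` with row space inside `W`. -/
def shortenRow (C : Submodule F (Matrix (Fin n) (Fin m) F)) (W : Submodule F (Fin m → F)) :
    Submodule F (Matrix (Fin n) (Fin m) F) where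
  carrier := {M | M ∈ C ∧ rowsp M ≤ W}
  zero_mem' := ⟨C.zero_mem, (rowsp_le_iff _ _).2 fun _ => W.zero_mem⟩
  add_mem' := fun ha hb => ⟨C.add_mem ha.1 hb.1, (rowsp_le_iff _ _).2 fun j =>
    W.add_mem ((rowsp_le_iff _ _).1 ha.2 j) ((rowsp_le_iff _ _).1 hb.2 j)⟩
  smul_mem' := fun c _ hx => ⟨C.smul_mem c hx.1, (rowsp_le_iff _ _).2 fun j =>
    W.smul_mem c ((rowsp_le_iff _ _).1 hx.2 j)⟩

theorem perp_anti {l : ℕ} {V W : Submodule F (Fin l → F)} (h : V ≤ W) : perp W ≤ perp V :=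
  fun _ hx v hv => hx v (h hv)

theorem perp_sup {l : ℕ} (V W : Submodule F (Fin l → F)) : perp (V ⊔ W) = perp V ⊓ perp W := by
  apply le_antisymm
  · exact le_inf (perp_anti le_sup_left) (perp_anti le_sup_right)
  · rintro x ⟨hV, hW⟩ u hu
    obtain ⟨v, hv, w, hw, rfl⟩ := Submodule.mem_sup.1 hu
    rw [add_dotProduct, hV v hv, hW w hw, add_zero]

/-- The rank-function axioms for a family of subspaces `S V` of `C`. -/
theorem isQRankFunction_of_family {l k : ℕ} {X : Type*} [AddCommGroup X] [Module F X]
    [FiniteDimensional F X]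
    (C : Submodule F X) (S : Submodule F (Fin l → F) → Submodule F X)
    (hC : ∀ V, S V ≤ C) (hanti : ∀ V W, V ≤ W → S W ≤ S V)
    (hsup : ∀ V W, S V ⊓ S W ≤ S (V ⊔ W))
    (hdim : ∀ V, finrank F C ≤ finrank F (S V) + k * finrank F V) :
    IsQRankFunction (fun V => ((finrank F C : ℚ) - finrank F (S V)) / k) := by
  have hk : (0 : ℚ) ≤ k := Nat.cast_nonneg k
  refine ⟨fun V => ?_, fun V => ?_, fun V W h => ?_, fun V W => ?_⟩
  · have h : (finrank F (S V) : ℚ) ≤ finrank F C := by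
      exact_mod_cast Submodule.finrank_mono (hC V)
    exact div_nonneg (by linarith) hk
  · have h : (finrank F C : ℚ) ≤ finrank F (S V) + k * finrank F V := by exact_mod_cast hdim V
    exact div_le_of_le_mul₀ hk (Nat.cast_nonneg _) (by linarith)
  · have h : (finrank F (S W) : ℚ) ≤ finrank F (S V) := by
      exact_mod_cast Submodule.finrank_mono (hanti V W h)
    exact div_le_div_of_nonneg_right (by linarith) hk
  · have h1 : (finrank F (S V) : ℚ) + finrank F (S W) ≤
        finrank F (S (V ⊔ W)) + finrank F (S (V ⊓ W)) := by
      have e := Submodule.finrank_sup_add_finrank_inf_eq (S V) (S W)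
      have a := Submodule.finrank_mono (hsup V W)
      have b := Submodule.finrank_mono
        (sup_le (hanti _ _ (inf_le_left : V ⊓ W ≤ V)) (hanti _ _ (inf_le_right : V ⊓ W ≤ W)))
      exact_mod_cast (by omega : finrank F (S V) + finrank F (S W) ≤
        finrank F (S (V ⊔ W)) + finrank F (S (V ⊓ W)))
    rw [← add_div, ← add_div]
    exact div_le_div_of_nonneg_right (by linarith) hk

/-- If `S` contains the part of `C` killed by a linear map into `V → F^k`, then
`dim C ≤ dim S + k dim V`. -/
theorem dim_bound {l k : ℕ} {X : Type*} [AddCommGroup X] [Module F X] [FiniteDimensional F X]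
    (C S : Submodule F X) (V : Submodule F (Fin l → F)) (f : X →ₗ[F] (V →ₗ[F] (Fin k → F)))
    (h : ∀ x ∈ C, f x = 0 → x ∈ S) :
    finrank F C ≤ finrank F S + k * finrank F V := by
  have e := LinearMap.finrank_range_add_finrank_ker (f.comp C.subtype)
  have a : finrank F (LinearMap.range (f.comp C.subtype)) ≤ k * finrank F V := by
    refine (Submodule.finrank_le _).trans ?_
    rw [Module.finrank_linearMap, Module.finrank_fin_fun, mul_comm]
  have b : finrank F (LinearMap.ker (f.comp C.subtype)) ≤ finrank F S := by
    rw [← Submodule.finrank_map_subtype_eq]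
    apply Submodule.finrank_mono
    rintro _ ⟨x, hx, rfl⟩
    exact h x x.2 hx
  omega

theorem isQRankFunction_col (C : Submodule F (Matrix (Fin n) (Fin m) F)) :
    IsQRankFunction (fun V : Submodule F (Fin n → F) =>
      ((finrank F C : ℚ) - finrank F (shortenCol C (perp V))) / m) :=
  isQRankFunction_of_family (k := m) C (fun V => shortenCol C (perp V)) (fun _ _ h => h.1)
    (fun _ _ h _ hM => ⟨hM.1, hM.2.trans (perp_anti h)⟩)
    (fun V W _ hM => ⟨hM.1.1, by rw [perp_sup]; exact le_inf hM.1.2 hM.2.2⟩)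
    (fun V => dim_bound C _ V
      { toFun := fun M => M.vecMulLinear.comp V.subtype
        map_add' := fun A B => by ext v : 1; exact Matrix.vecMul_add A B _
        map_smul' := fun c A => by ext v : 1; exact Matrix.vecMul_smul _ c A }
      (fun M hM h => ⟨hM, (colsp_le_iff _ _).2 fun j v hv =>
        congrFun (LinearMap.congr_fun h ⟨v, hv⟩) j⟩))

theorem isQRankFunction_row (C : Submodule F (Matrix (Fin n) (Fin m) F)) :
    IsQRankFunction (fun W : Submodule F (Fin m → F) =>
      ((finrank F C : ℚ) - finrank F (shortenRow C (perp W))) / n) :=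
  isQRankFunction_of_family (k := n) C (fun W => shortenRow C (perp W)) (fun _ _ h => h.1)
    (fun _ _ h _ hM => ⟨hM.1, hM.2.trans (perp_anti h)⟩)
    (fun V W _ hM => ⟨hM.1.1, by rw [perp_sup]; exact le_inf hM.1.2 hM.2.2⟩)
    (fun W => dim_bound C _ W
      { toFun := fun M => M.mulVecLin.comp W.subtype
        map_add' := fun A B => by ext v : 1; exact Matrix.add_mulVec A B _
        map_smul' := fun c A => by ext v : 1; exact Matrix.smul_mulVec c A _ }
      (fun M hM h => ⟨hM, (rowsp_le_iff _ _).2 fun j v hv =>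
        (dotProduct_comm _ _).trans (congrFun (LinearMap.congr_fun h ⟨v, hv⟩) j)⟩))

/-- The column `q`-polymatroid of a code, with
`rho V = (dim C - dim C(V^⊥, c)) / m`. -/
noncomputable def colPM (C : Submodule F (Matrix (Fin n) (Fin m) F)) :
    QPolymatroid F (Fin n → F) where
  rho V := ((finrank F C : ℚ) - finrank F (shortenCol C (perp V))) / m
  isQRankFunction := isQRankFunction_col C

/-- The row `q`-polymatroid of a code, with
`rho W = (dim C - dim C(W^⊥, r)) / n`. -/
noncomputable def rowPM (C : Submodule F (Matrix (Fin n) (Fin m) F)) :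
    QPolymatroid F (Fin m → F) where
  rho W := ((finrank F C : ℚ) - finrank F (shortenRow C (perp W))) / n
  isQRankFunction := isQRankFunction_row C

/-- The maximum rank of a matrix in the code. -/
noncomputable def maxrk (C : Submodule F (Matrix (Fin n) (Fin m) F)) : ℕ :=
  sSup {r | ∃ M ∈ C, M.rank = r}

/-- Optimal anticodes in `F^{n×m}`, for `m ≥ n`. -/
def IsOptimalAnticode (A : Submodule F (Matrix (Fin n) (Fin m) F)) : Prop :=
  finrank F A = m * maxrk A

/-- The dimensions of the optimal anticodes that meet `C` in dimension at least `i`. -/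
def anticodeDims (C : Submodule F (Matrix (Fin n) (Fin m) F)) (i : ℕ) : Set ℕ :=
  {d | ∃ A : Submodule F (Matrix (Fin n) (Fin m) F),
    IsOptimalAnticode A ∧ i ≤ finrank F (C ⊓ A : Submodule F _) ∧ finrank F A = d}

/-- The `i`-th generalized weight `a_i(C)`, for `m ≥ n`. -/
noncomputable def genWeight (C : Submodule F (Matrix (Fin n) (Fin m) F)) (i : ℕ) : ℚ :=
  (1 / (m : ℚ)) * (sInf (anticodeDims C i) : ℕ)

/-- `b_i^c(C)`: `n` minus the maximal dimension of a flat of the column `q`-polymatroid of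
rank at most `rho_c(F^n) - i/m`. -/
noncomputable def flatWeightCol (C : Submodule F (Matrix (Fin n) (Fin m) F)) (i : ℕ) : ℚ :=
  (n : ℚ) - (sSup ((colPM C).flatDims ((i : ℚ) / m)) : ℕ)

/-- `b_i^r(C)`: `m` minus the maximal dimension of a flat of the row `q`-polymatroid of
rank at most `rho_r(F^m) - i/n`. -/
noncomputable def flatWeightRow (C : Submodule F (Matrix (Fin n) (Fin m) F)) (i : ℕ) : ℚ :=
  (m : ℚ) - (sSup ((rowPM C).flatDims ((i : ℚ) / n)) : ℕ)

end RankMetric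

/-!
Regard an `n × m` matrix as a linear map `E = F^m → G = F^n`, where `dim G ≤ dim E`. Relative to a
basis `b` of `E`, the dimension of a space `A` of maps is the sum of the dimensions of its leading
spaces at the `b j`, and linearly independent leading values at `k` different `b j` give a map in
`A` of rank at least `k`. If all ranks are at most `r`, then by Rado's theorem on independent
transversals there is a `t ≤ r` such that at most `r - t` leading spaces have dimension more than
`t`. This yields `dim A ≤ r * dim E` and, in the case of equality, that all leading spaces have
dimension `r`, unless `dim E = dim G` and each of them is `0` or `G`.

For a linear form `φ ≠ 0`, the space of the `g` with `φ(·) g ∈ A` is the first leading space of `A`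
in a suitable basis. If all these spaces have dimension `r`, they are equal to one space `V`, and
`A` consists of all the maps into `V`. Otherwise `dim E = dim G` and one of them is `0` or `G`,
which excludes these two values for the transposed maps; hence `A` consists of all the maps that
vanish on some subspace `K`. So the optimal anticodes are the spaces of all matrices with columns
in a fixed space and, if `n = m`, those of all matrices with rows in a fixed space, and the
generalized weight is the least dimension of a space that supports enough of the code.

Since `ρ_c(V) ≤ ρ_c(F^n) - i/m` means `dim C(V^⊥, c) ≥ i`, and a space of maximal dimension with
this property is a flat, `b_i^c(C)` is the least dimension of a `U` with `dim C(U, c) ≥ i`; the row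
weights are the column weights of the transposed code. For `i = 1` both are the least rank of a
nonzero matrix in `C`.
-/

namespace RankMetric

open Module LinearMap

variable {F E G : Type*} [Field F] [AddCommGroup E] [Module F E] [AddCommGroup G] [Module F G]

section LeadingSpace

variable {m : ℕ}

/-- The maps in `A` that vanish on every vector of the basis `b` of index at least `k`: the steps
of the filtration of `A` whose graded pieces are the leading spaces. -/
def tailVanishing (A : Submodule F (E →ₗ[F] G)) (b : Basis (Fin m) F E) (k : ℕ) :
    Submodule F (E →ₗ[F] G) where
  carrier := {f | f ∈ A ∧ ∀ i : Fin m, k ≤ i → f (b i) = 0}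
  zero_mem' := ⟨A.zero_mem, fun _ _ => rfl⟩
  add_mem' := fun hf hg => ⟨A.add_mem hf.1 hg.1, fun i hi => by
    rw [LinearMap.add_apply, hf.2 i hi, hg.2 i hi, add_zero]⟩
  smul_mem' := fun c _ hf => ⟨A.smul_mem c hf.1, fun i hi => by
    rw [LinearMap.smul_apply, hf.2 i hi, smul_zero]⟩

/-- The leading space of `A` at `b j`: the values at `b j` of the maps in `A` for which `b j` is
the last basis vector that need not be mapped to `0`. -/
noncomputable def leadingSpace (A : Submodule F (E →ₗ[F] G)) (b : Basis (Fin m) F E) (j : Fin m) :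
    Submodule F G :=
  (tailVanishing A b (j + 1)).map (applyₗ (b j))

theorem mem_leadingSpace {A : Submodule F (E →ₗ[F] G)} {b : Basis (Fin m) F E} {j : Fin m}
    {g : G} : g ∈ leadingSpace A b j ↔ ∃ f ∈ A, (∀ i, j < i → f (b i) = 0) ∧ f (b j) = g :=
  ⟨fun ⟨f, hf, hfg⟩ => ⟨f, hf.1, hf.2, hfg⟩, fun ⟨f, hfA, hf, hfg⟩ => ⟨f, ⟨hfA, hf⟩, hfg⟩⟩

theorem tailVanishing_zero (A : Submodule F (E →ₗ[F] G)) (b : Basis (Fin m) F E) :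
    tailVanishing A b 0 = ⊥ :=
  (Submodule.eq_bot_iff _).2 fun _ hf => b.ext fun i => hf.2 i (Nat.zero_le _)

theorem tailVanishing_length (A : Submodule F (E →ₗ[F] G)) (b : Basis (Fin m) F E) :
    tailVanishing A b m = A :=
  Submodule.ext fun _ => ⟨And.left, fun hf => ⟨hf, fun i hi => absurd i.2 hi.not_gt⟩⟩

theorem tailVanishing_succ_inf_ker (A : Submodule F (E →ₗ[F] G)) (b : Basis (Fin m) F E)
    (j : Fin m) :
    tailVanishing A b (j + 1) ⊓ ker (applyₗ (b j) : (E →ₗ[F] G) →ₗ[F] G) =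
      tailVanishing A b j := by
  ext f
  refine ⟨fun ⟨hf, hfj⟩ => ⟨hf.1, fun i hi => ?_⟩,
    fun hf => ⟨⟨hf.1, fun i hi => hf.2 i (Nat.le_of_succ_le hi)⟩, hf.2 j le_rfl⟩⟩
  rcases hi.eq_or_lt with hij | hij
  · rwa [← Fin.ext hij]
  · exact hf.2 i hij

theorem finrank_map_add_finrank_inf_ker {V W : Type*} [AddCommGroup V] [Module F V]
    [AddCommGroup W] [Module F W] [FiniteDimensional F V] (f : V →ₗ[F] W) (S : Submodule F V) :
    finrank F (S.map f) + finrank F (S ⊓ ker f : Submodule F V) = finrank F S := by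
  rw [← finrank_range_add_finrank_ker (f.domRestrict S), range_domRestrict, ker_domRestrict,
    ← Submodule.finrank_map_subtype_eq S, Submodule.map_comap_subtype]

theorem sum_finrank_leadingSpace [FiniteDimensional F E] [FiniteDimensional F G]
    (A : Submodule F (E →ₗ[F] G)) (b : Basis (Fin m) F E) :
    ∑ j, finrank F (leadingSpace A b j) = finrank F A := by
  have hstep (j : Fin m) : (finrank F (leadingSpace A b j) : ℤ) =
      finrank F (tailVanishing A b (j + 1)) - finrank F (tailVanishing A b j) := by
    rw [← finrank_map_add_finrank_inf_ker (applyₗ (b j)), tailVanishing_succ_inf_ker,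
      leadingSpace]
    push_cast
    ring
  have htelescope := Finset.sum_range_sub (fun k => (finrank F (tailVanishing A b k) : ℤ)) m
  rw [tailVanishing_zero, tailVanishing_length, finrank_bot, Nat.cast_zero, sub_zero] at htelescope
  zify
  rw [Finset.sum_congr rfl fun j _ => hstep j, ← htelescope, Finset.sum_range]

end LeadingSpace

section Transversal

theorem exists_linearIndepOn_update_add_smul {ι : Type*} [DecidableEq ι] {v : ι → G} {s : Set ι}
    (hv : LinearIndepOn F v s) {a : ι} (ha : a ∈ s) (w : G) :
    ∃ c : F, LinearIndepOn F (Function.update v a (w + c • v a)) s := by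
  obtain ⟨t, hat, rfl⟩ : ∃ t, a ∉ t ∧ insert a t = s :=
    ⟨s \ {a}, by simp, Set.insert_sdiff_self_of_mem ha⟩
  obtain ⟨hvt, hva⟩ := (linearIndepOn_insert hat).1 hv
  have hupdate : ∀ x ∉ Submodule.span F (v '' t),
      LinearIndepOn F (Function.update v a x) (insert a t) := by
    intro x hx
    have heq : Set.EqOn v (Function.update v a x) t :=
      fun i hi => (Function.update_of_ne (ne_of_mem_of_not_mem hi hat) _ _).symm
    rw [linearIndepOn_insert hat, ← heq.image_eq, Function.update_self]
    exact ⟨hvt.congr heq, hx⟩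
  by_cases hw : w ∈ Submodule.span F (v '' t)
  · exact ⟨1, hupdate _ (by rwa [one_smul, Submodule.add_mem_iff_right _ hw])⟩
  · exact ⟨0, hupdate _ (by rwa [zero_smul, add_zero])⟩

theorem card_le_finrank_range_of_linearIndepOn [FiniteDimensional F G] {ι : Type*} {f : E →ₗ[F] G}
    {e : ι → E} {J : Finset ι} (h : LinearIndepOn F (fun j => f (e j)) (J : Set ι)) :
    J.card ≤ finrank F (range f) := by
  have hrange : LinearIndependent F fun j : J => f.rangeRestrict (e j) :=
    LinearIndependent.of_comp (range f).subtype h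
  simpa only [Fintype.card_coe] using hrange.fintype_card_le_finrank

/-- Processing `J` downwards, a multiple of the map realising `g j` as a leading value changes
`f (b j)` without touching the values at later basis vectors. -/
theorem exists_card_le_finrank_range [FiniteDimensional F G] {m : ℕ}
    {A : Submodule F (E →ₗ[F] G)} {b : Basis (Fin m) F E} {J : Finset (Fin m)} {g : Fin m → G}
    (hg : ∀ j ∈ J, g j ∈ leadingSpace A b j) (hli : LinearIndepOn F g (J : Set (Fin m))) :
    ∃ f ∈ A, J.card ≤ finrank F (range f) := by
  have hmixed : ∀ I ⊆ J, ∃ f ∈ A,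
      LinearIndepOn F (I.piecewise (fun j => f (b j)) g) (J : Set (Fin m)) := by
    intro I
    induction I using Finset.induction_on_min with
    | empty => exact fun _ => ⟨0, A.zero_mem, by rwa [Finset.piecewise_empty]⟩
    | insert a s has ih =>
      intro hI
      have haJ := hI (Finset.mem_insert_self a s)
      obtain ⟨f, hf, hind⟩ := ih ((Finset.subset_insert a s).trans hI)
      obtain ⟨p, hp, hp_tail, hpa⟩ := mem_leadingSpace.1 (hg a haJ)
      obtain ⟨c, hc⟩ := exists_linearIndepOn_update_add_smul hind haJ (f (b a))
      rw [Finset.piecewise_eq_of_notMem s _ _ fun h => lt_irrefl a (has a h)] at hc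
      refine ⟨f + c • p, A.add_mem hf (A.smul_mem c hp), ?_⟩
      have hagree : s.piecewise (fun j => (f + c • p) (b j)) g =
          s.piecewise (fun j => f (b j)) g :=
        s.piecewise_congr (fun j hj => by simp [hp_tail j (has j hj)]) fun _ _ => rfl
      rw [Finset.piecewise_insert, hagree, LinearMap.add_apply, LinearMap.smul_apply, hpa]
      exact hc
  obtain ⟨f, hf, hind⟩ := hmixed J subset_rfl
  exact ⟨f, hf, card_le_finrank_range_of_linearIndepOn
    (hind.congr fun j hj => Finset.piecewise_eq_of_mem _ _ _ hj)⟩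

/-- A quantitative form of Rado's theorem on independent transversals, by greedy choice. -/
theorem exists_linearIndepOn_of_card_le [FiniteDimensional F G] {ι : Type*}
    (V : ι → Submodule F G) (k : ℕ) (S : Finset ι)
    (hS : ∀ t < k, k - t ≤ (S.filter fun j => t < finrank F (V j)).card) :
    ∃ J ⊆ S, J.card = k ∧ ∃ g : ι → G, (∀ j ∈ J, g j ∈ V j) ∧ LinearIndepOn F g (J : Set ι) := by
  classical
  induction k generalizing S with
  | zero =>
    exact ⟨∅, S.empty_subset, rfl, 0, by simp, by simp⟩
  | succ k ih =>
    obtain ⟨a, ha⟩ := Finset.card_pos.1 (lt_of_lt_of_le (by omega) (hS k (by omega)))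
    obtain ⟨haS, hka⟩ := Finset.mem_filter.1 ha
    obtain ⟨J, hJS, hJk, g, hg, hli⟩ := ih (S.erase a) fun t ht => by
      have hSt := hS t (by omega)
      have hpred := Finset.pred_card_le_card_erase
        (s := S.filter fun j => t < finrank F (V j)) (a := a)
      rw [Finset.filter_erase]
      omega
    have haJ : a ∉ J := fun h => Finset.notMem_erase a S (hJS h)
    have hspan : finrank F (Submodule.span F (g '' (J : Set ι))) ≤ k := by
      rw [← Finset.coe_image]
      exact (finrank_span_finset_le_card _).trans (Finset.card_image_le.trans hJk.le)
    obtain ⟨x, hxV, hx⟩ : ∃ x ∈ V a, x ∉ Submodule.span F (g '' (J : Set ι)) :=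
      Set.not_subset.1 fun h => (hka.trans_le (Submodule.finrank_mono h)).not_ge hspan
    have heq : Set.EqOn g (Function.update g a x) (J : Set ι) :=
      fun j hj => (Function.update_of_ne (ne_of_mem_of_not_mem hj haJ) _ _).symm
    refine ⟨insert a J, Finset.insert_subset haS (hJS.trans (S.erase_subset a)),
      by rw [Finset.card_insert_of_notMem haJ, hJk], Function.update g a x, ?_, ?_⟩
    · refine Finset.forall_mem_insert _ _ _ |>.2 ⟨by rwa [Function.update_self], fun j hj => ?_⟩
      rw [← heq hj]
      exact hg j hj
    · rw [Finset.coe_insert, linearIndepOn_insert haJ, ← heq.image_eq, Function.update_self]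
      exact ⟨hli.congr heq, hx⟩

end Transversal

section Counting

variable {ι : Type*} [Fintype ι] {d : ι → ℕ} {n r t : ℕ}

theorem sum_add_mul_le_of_card_filter_lt_le (hnι : n ≤ Fintype.card ι) (hr : r ≤ n) (ht : t ≤ r)
    (hd : ∀ j, d j ≤ n) (hcard : (Finset.univ.filter fun j => t < d j).card ≤ r - t) :
    ∑ j, d j + (r - t) * (Fintype.card ι - n + t) ≤ Fintype.card ι * r := by
  have hd' (j : ι) : d j ≤ t + if t < d j then n - t else 0 := by
    have := hd j
    split_ifs <;> omega
  have hsum : ∑ j, d j ≤ Fintype.card ι * t + (r - t) * (n - t) := by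
    refine (Finset.sum_le_sum fun j _ => hd' j).trans ?_
    rw [Finset.sum_add_distrib, Finset.sum_const, ← Finset.sum_filter, Finset.sum_const,
      Finset.card_univ, smul_eq_mul, smul_eq_mul]
    gcongr
  refine (Nat.add_le_add_right hsum _).trans_eq ?_
  zify [hnι, ht, ht.trans hr]
  ring

theorem eq_of_card_mul_le_sum (hd : ∀ j, d j ≤ r) (hsum : Fintype.card ι * r ≤ ∑ j, d j) (j : ι) :
    d j = r := by
  have hconst : ∑ _j : ι, r = Fintype.card ι * r := by simp
  exact (Finset.sum_eq_sum_iff_of_le fun j _ => hd j).1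
    ((Finset.sum_le_sum fun j _ => hd j).antisymm (hconst.trans_le hsum)) j (Finset.mem_univ j)

theorem eq_zero_or_eq_of_mul_le_sum (hd : ∀ j, d j ≤ n)
    (hcard : (Finset.univ.filter fun j => 0 < d j).card ≤ r) (hsum : r * n ≤ ∑ j, d j) (j : ι) :
    d j = 0 ∨ d j = n := by
  have hd' (j : ι) : d j ≤ if 0 < d j then n else 0 := by
    have := hd j
    split_ifs <;> omega
  have hle : ∑ j, (if 0 < d j then n else 0) ≤ r * n := by
    rw [← Finset.sum_filter, Finset.sum_const, smul_eq_mul]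
    gcongr
  have hj := (Finset.sum_eq_sum_iff_of_le fun j _ => hd' j).1
    ((Finset.sum_le_sum fun j _ => hd' j).antisymm (hle.trans hsum)) j (Finset.mem_univ j)
  split_ifs at hj with h
  · exact Or.inr hj
  · exact Or.inl hj

end Counting

section Extremal

variable [FiniteDimensional F G] {A : Submodule F (E →ₗ[F] G)} {m r : ℕ}

theorem exists_card_filter_lt_finrank_leadingSpace_le (hA : ∀ f ∈ A, finrank F (range f) ≤ r)
    (b : Basis (Fin m) F E) :
    ∃ t ≤ r, (Finset.univ.filter fun j => t < finrank F (leadingSpace A b j)).card ≤ r - t := by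
  by_contra! h
  obtain ⟨J, -, hJ, g, hg, hli⟩ := exists_linearIndepOn_of_card_le (leadingSpace A b) (r + 1)
    Finset.univ fun t ht => by have := h t (Nat.le_of_lt_succ ht); omega
  obtain ⟨f, hf, hle⟩ := exists_card_le_finrank_range hg hli
  have := hA f hf
  omega

variable [FiniteDimensional F E]

theorem finrank_le_mul_of_finrank_range_le (hGE : finrank F G ≤ finrank F E)
    (hA : ∀ f ∈ A, finrank F (range f) ≤ r) : finrank F A ≤ finrank F E * r := by
  rcases le_total r (finrank F G) with hr | hr
  · obtain ⟨t, ht, hcard⟩ := exists_card_filter_lt_finrank_leadingSpace_le hA (finBasis F E)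
    have hsum := sum_add_mul_le_of_card_filter_lt_le (by rwa [Fintype.card_fin]) hr ht
      (fun _ => Submodule.finrank_le _) hcard
    rw [sum_finrank_leadingSpace, Fintype.card_fin] at hsum
    exact (Nat.le_add_right _ _).trans hsum
  · refine (Submodule.finrank_le A).trans ?_
    rw [finrank_linearMap]
    exact Nat.mul_le_mul_left _ hr

/-- `A` is extremal for the rank bound `r`: its maps have rank at most `r`, and its dimension is
`r * dim E`, the largest possible value when `dim G ≤ dim E`. -/
structure IsExtremal (A : Submodule F (E →ₗ[F] G)) (r : ℕ) : Prop where
  finrank_range_le : ∀ f ∈ A, finrank F (range f) ≤ r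
  finrank_eq : finrank F A = finrank F E * r

theorem IsExtremal.exists_finrank_range_eq (hA : IsExtremal A r)
    (hGE : finrank F G ≤ finrank F E) (hE : 0 < finrank F E) :
    ∃ f ∈ A, finrank F (range f) = r := by
  by_contra! hne
  have hlt (f) (hf : f ∈ A) : finrank F (range f) < r :=
    lt_of_le_of_ne (hA.finrank_range_le f hf) (hne f hf)
  have hr : 0 < r := (Nat.zero_le _).trans_lt (hlt 0 A.zero_mem)
  have hle := finrank_le_mul_of_finrank_range_le hGE fun f hf => Nat.le_sub_one_of_lt (hlt f hf)
  rw [hA.finrank_eq] at hle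
  exact (Nat.sub_one_lt hr.ne').not_ge (Nat.le_of_mul_le_mul_left hle hE)

theorem IsExtremal.finrank_leadingSpace_dichotomy (hA : IsExtremal A r)
    (hGE : finrank F G ≤ finrank F E) (hr : r ≤ finrank F G) (b : Basis (Fin m) F E) :
    (∀ j, finrank F (leadingSpace A b j) = r) ∨ (finrank F G = finrank F E ∧
      ∀ j, finrank F (leadingSpace A b j) = 0 ∨ finrank F (leadingSpace A b j) = finrank F G) := by
  have hm : finrank F E = m := finrank_eq_card_basis b |>.trans (Fintype.card_fin m)
  obtain ⟨t, ht, hcard⟩ := exists_card_filter_lt_finrank_leadingSpace_le hA.finrank_range_le b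
  have hle (j) : finrank F (leadingSpace A b j) ≤ finrank F G := Submodule.finrank_le _
  have hsum : ∑ j, finrank F (leadingSpace A b j) = m * r := by
    rw [sum_finrank_leadingSpace, hA.finrank_eq, hm]
  have hdefect := sum_add_mul_le_of_card_filter_lt_le (by rwa [Fintype.card_fin, ← hm]) hr ht
    hle hcard
  rw [hsum, Fintype.card_fin, add_le_iff_nonpos_right, nonpos_iff_eq_zero, mul_eq_zero] at hdefect
  rcases hdefect with hrt | hmt
  · rw [hrt, nonpos_iff_eq_zero, Finset.card_eq_zero, Finset.filter_eq_empty_iff] at hcard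
    refine Or.inl fun j => eq_of_card_mul_le_sum (fun j => ?_) (by rw [hsum, Fintype.card_fin]) j
    exact (not_lt.1 (hcard (Finset.mem_univ j))).trans ht
  · obtain rfl : t = 0 := by omega
    have hGm : finrank F G = m := by omega
    refine Or.inr ⟨hGm.trans hm.symm, fun j => eq_zero_or_eq_of_mul_le_sum hle hcard ?_ j⟩
    rw [hsum, hGm, mul_comm, Nat.sub_zero]

end Extremal

section RankOne

variable {A : Submodule F (E →ₗ[F] G)}

/-- The vectors `g` such that the map `x ↦ φ x • g`, of rank at most one, lies in `A`. -/
def rankOneSpace (A : Submodule F (E →ₗ[F] G)) (φ : Dual F E) : Submodule F G :=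
  A.comap (smulRightₗ φ)

theorem mem_rankOneSpace {φ : Dual F E} {g : G} : g ∈ rankOneSpace A φ ↔ φ.smulRight g ∈ A :=
  Iff.rfl

theorem rankOneSpace_coord_le_leadingSpace {m : ℕ} (b : Basis (Fin m) F E) (j : Fin m) :
    rankOneSpace A (b.coord j) ≤ leadingSpace A b j :=
  fun _ hg => mem_leadingSpace.2 ⟨_, hg, fun i hi => by simp [hi.ne'], by simp⟩

theorem leadingSpace_zero {k : ℕ} (b : Basis (Fin (k + 1)) F E) :
    leadingSpace A b 0 = rankOneSpace A (b.coord 0) := by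
  refine le_antisymm (fun g hg => ?_) (rankOneSpace_coord_le_leadingSpace b 0)
  obtain ⟨f, hf, hf_tail, rfl⟩ := mem_leadingSpace.1 hg
  have hf_eq : f = (b.coord 0).smulRight (f (b 0)) := b.ext fun i => by
    rcases eq_or_ne i 0 with rfl | hi
    · simp
    · simp [hf_tail i (Fin.pos_iff_ne_zero.2 hi), hi]
  rwa [hf_eq] at hf

theorem exists_basis_coord_zero_eq [FiniteDimensional F E] {φ : Dual F E} (hφ : φ ≠ 0) :
    ∃ (k : ℕ) (b : Basis (Fin (k + 1)) F E), b.coord 0 = φ := by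
  obtain ⟨y, hy⟩ := φ.surjective hφ 1
  let b := Basis.mkFinCons y (finBasis F (ker φ))
    (fun c x hx h => by simpa [hy, mem_ker.1 hx] using congrArg φ h)
    (fun z => ⟨-φ z, by simp [hy]⟩)
  have hb : (b : Fin _ → E) = Fin.cons y ((↑) ∘ finBasis F (ker φ)) := Basis.coe_mkFinCons ..
  refine ⟨_, b, b.ext fun i => ?_⟩
  rw [b.coord_apply, b.repr_self, hb]
  cases i using Fin.cases with
  | zero => simp [hy]
  | succ i => simp

variable [FiniteDimensional F E] [FiniteDimensional F G] {r : ℕ}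

theorem IsExtremal.finrank_rankOneSpace_trichotomy (hA : IsExtremal A r)
    (hGE : finrank F G ≤ finrank F E) (hr : r ≤ finrank F G) {φ : Dual F E} (hφ : φ ≠ 0) :
    finrank F (rankOneSpace A φ) = r ∨ (finrank F G = finrank F E ∧
      (rankOneSpace A φ = ⊥ ∨ rankOneSpace A φ = ⊤)) := by
  obtain ⟨k, b, rfl⟩ := exists_basis_coord_zero_eq hφ
  rw [← leadingSpace_zero]
  refine (hA.finrank_leadingSpace_dichotomy hGE hr b).imp (fun h => h 0) fun ⟨hGE', h⟩ =>
    ⟨hGE', (h 0).imp Submodule.finrank_eq_zero.1 Submodule.eq_top_of_finrank_eq⟩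

end RankOne

section MapsInto

variable {A : Submodule F (E →ₗ[F] G)}

theorem mem_compatibleMaps_top {V : Submodule F G} {f : E →ₗ[F] G} :
    f ∈ Submodule.compatibleMaps ⊤ V ↔ range f ≤ V :=
  top_le_iff.trans range_le_iff_comap.symm

theorem compatibleMaps_top_le_iff [FiniteDimensional F E] {V : Submodule F G} :
    Submodule.compatibleMaps ⊤ V ≤ A ↔ ∀ φ : Dual F E, V ≤ rankOneSpace A φ := by
  refine ⟨fun h φ g hg => h fun x _ => V.smul_mem _ hg, fun h f hf => ?_⟩
  let b := finBasis F E
  have hf_sum : f = ∑ i, (b.coord i).smulRight (f (b i)) :=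
    b.ext fun j => by simp [Finsupp.single_apply]
  rw [hf_sum]
  exact A.sum_mem fun i _ => h _ (hf trivial)

theorem finrank_compatibleMaps_top [FiniteDimensional F E] [FiniteDimensional F G]
    (V : Submodule F G) :
    finrank F (Submodule.compatibleMaps (⊤ : Submodule F E) V) = finrank F E * finrank F V := by
  have hrange : range (V.subtype.compRight F (M := E)) = Submodule.compatibleMaps ⊤ V := by
    ext f
    rw [mem_compatibleMaps_top]
    refine ⟨?_, fun hf => ⟨f.codRestrict V fun x => hf ⟨x, rfl⟩, rfl⟩⟩
    rintro ⟨h, rfl⟩ _ ⟨x, rfl⟩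
    exact (h x).2
  rw [← hrange, finrank_range_of_inj fun f g h => LinearMap.ext fun x =>
    Subtype.ext (LinearMap.congr_fun h x), finrank_linearMap]

theorem range_sup_span_singleton_le_range_add_smulRight {f : E →ₗ[F] G} {φ : Dual F E} {x : E}
    (hfx : f x = 0) (hφx : φ x ≠ 0) (g : G) :
    range f ⊔ Submodule.span F {g} ≤ range (f + φ.smulRight g) := by
  have hg : g ∈ range (f + φ.smulRight g) := ⟨(φ x)⁻¹ • x, by simp [hfx, hφx]⟩
  refine sup_le ?_ ((Submodule.span_singleton_le_iff_mem _ _).2 hg)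
  rintro _ ⟨z, rfl⟩
  have hz : f z = (f + φ.smulRight g) z - φ z • g := by simp
  rw [hz]
  exact Submodule.sub_mem _ ⟨z, rfl⟩ (Submodule.smul_mem _ _ hg)

variable [FiniteDimensional F G]

theorem rankOneSpace_le_range {f : E →ₗ[F] G} (hf : f ∈ A)
    (hmax : ∀ h ∈ A, finrank F (range h) ≤ finrank F (range f)) {φ : Dual F E} {x : E}
    (hfx : f x = 0) (hφx : φ x ≠ 0) : rankOneSpace A φ ≤ range f := by
  intro g hg
  by_contra hgf
  have hlt := Submodule.finrank_lt_finrank_of_lt (Submodule.lt_sup_iff_notMem.2 hgf)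
  exact (hlt.trans_le (Submodule.finrank_mono
    (range_sup_span_singleton_le_range_add_smulRight hfx hφx g))).not_ge
    (hmax _ (A.add_mem hf hg))

variable [FiniteDimensional F E] {r : ℕ}

/-- If `f ∈ A` has rank `r` and `f x = 0`, then `rankOneSpace A φ` is the range of `f` as soon as
`φ x ≠ 0`, and every linear form is a sum of two that do not vanish at `x`. -/
theorem IsExtremal.exists_eq_compatibleMaps_top (hA : IsExtremal A r)
    (hGE : finrank F G ≤ finrank F E) (hrE : r < finrank F E)
    (h : ∀ φ : Dual F E, φ ≠ 0 → finrank F (rankOneSpace A φ) = r) :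
    ∃ V : Submodule F G, finrank F V = r ∧ A = Submodule.compatibleMaps ⊤ V := by
  obtain ⟨f, hf, hfr⟩ := hA.exists_finrank_range_eq hGE (Nat.zero_lt_of_lt hrE)
  obtain ⟨x, hfx, hx⟩ : ∃ x ∈ ker f, x ≠ 0 := Submodule.exists_mem_ne_zero_of_ne_bot fun hker => by
    have hsum := finrank_range_add_finrank_ker f
    rw [hker, finrank_bot] at hsum
    omega
  have heq (φ : Dual F E) (hφx : φ x ≠ 0) : rankOneSpace A φ = range f :=
    Submodule.eq_of_le_of_finrank_eq
      (rankOneSpace_le_range hf (hfr.symm ▸ hA.finrank_range_le) hfx hφx)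
      (by rw [hfr, h φ (by rintro rfl; exact hφx rfl)])
  obtain ⟨ψ, hψx⟩ : ∃ ψ : Dual F E, ψ x ≠ 0 :=
    not_forall.1 (mt (forall_dual_apply_eq_zero_iff F x).1 hx)
  have hle : Submodule.compatibleMaps ⊤ (range f) ≤ A := by
    refine compatibleMaps_top_le_iff.2 fun φ g hg => ?_
    by_cases hφx : φ x = 0
    · have hψ : g ∈ rankOneSpace A ψ := by rwa [heq ψ hψx]
      have hφψ : g ∈ rankOneSpace A (φ - ψ) := by rwa [heq _ (by simpa [hφx] using hψx)]
      rw [mem_rankOneSpace] at hψ hφψ ⊢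
      convert A.add_mem hφψ hψ using 1
      ext; simp [sub_smul]
    · rwa [heq φ hφx]
  refine ⟨range f, hfr, (Submodule.eq_of_le_of_finrank_eq hle ?_).symm⟩
  rw [finrank_compatibleMaps_top, hfr, hA.finrank_eq]

end MapsInto

section Transpose

variable {A : Submodule F (E →ₗ[F] G)} {r : ℕ}

theorem transpose_injective :
    Function.Injective (Dual.transpose (R := F) (M := E) (M' := G)) := by
  intro f f' h
  ext x
  refine sub_eq_zero.1 ((forall_dual_apply_eq_zero_iff F _).1 fun γ => ?_)
  rw [map_sub, sub_eq_zero]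
  exact LinearMap.congr_fun (LinearMap.congr_fun h γ) x

theorem transpose_mem_map_transpose {f : E →ₗ[F] G} :
    Dual.transpose f ∈ A.map (Dual.transpose (R := F) (M' := G)) ↔ f ∈ A :=
  transpose_injective.mem_set_image

theorem mem_rankOneSpace_map_transpose {φ : Dual F E} {g : G} :
    φ ∈ rankOneSpace (A.map Dual.transpose) (Dual.eval F G g) ↔ g ∈ rankOneSpace A φ := by
  have h : (Dual.eval F G g).smulRight φ = Dual.transpose (φ.smulRight g) := by
    ext γ x
    simp [Dual.transpose_apply, mul_comm]
  rw [mem_rankOneSpace, h, transpose_mem_map_transpose]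
  rfl

theorem isExtremal_map_transpose (hA : ∀ f ∈ A, finrank F (range f) ≤ r)
    (hdim : finrank F A = finrank F G * r) :
    IsExtremal (A.map (Dual.transpose (R := F) (M := E) (M' := G))) r where
  finrank_range_le := by
    rintro _ ⟨f, hf, rfl⟩
    exact (finrank_range_dualMap_eq_finrank_range f).trans_le (hA f hf)
  finrank_eq := by
    rw [← (Submodule.equivMapOfInjective _ transpose_injective A).finrank_eq, hdim,
      Subspace.dual_finrank_eq]

theorem eq_compatibleMaps_bot_of_map_transpose_eq [FiniteDimensional F E]
    {V : Submodule F (Dual F E)}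
    (h : A.map Dual.transpose = Submodule.compatibleMaps ⊤ V) :
    A = Submodule.compatibleMaps V.dualCoannihilator ⊥ := by
  ext f
  rw [← transpose_mem_map_transpose, h, mem_compatibleMaps_top]
  change range f.dualMap ≤ V ↔ V.dualCoannihilator ≤ ker f
  rw [range_dualMap_eq_dualAnnihilator_ker]
  conv_lhs => rw [← Subspace.dualCoannihilator_dualAnnihilator_eq (W := V)]
  exact Subspace.dualAnnihilator_le_dualAnnihilator_iff

variable [FiniteDimensional F E] [FiniteDimensional F G]

theorem exists_eq_compatibleMaps_bot (hA : ∀ f ∈ A, finrank F (range f) ≤ r)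
    (hdim : finrank F A = finrank F G * r) (hEG : finrank F E ≤ finrank F G)
    (hrG : r < finrank F G)
    (h : ∀ g : G, g ≠ 0 → finrank F (rankOneSpace (A.map Dual.transpose) (Dual.eval F G g)) = r) :
    ∃ K : Submodule F E, finrank F K + r = finrank F E ∧ A = Submodule.compatibleMaps K ⊥ := by
  obtain ⟨V, hV, hAV⟩ := (isExtremal_map_transpose hA hdim).exists_eq_compatibleMaps_top
    (by simpa using hEG) (by simpa using hrG) fun γ hγ => by
      obtain ⟨g, rfl⟩ := (evalEquiv F G).surjective γ
      exact h g (by rintro rfl; exact hγ (map_zero _))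
  refine ⟨V.dualCoannihilator, ?_, eq_compatibleMaps_bot_of_map_transpose_eq hAV⟩
  rw [← hV, add_comm]
  exact Subspace.finrank_add_finrank_dualCoannihilator_eq V

theorem exists_eq_compatibleMaps_bot_of_finrank_lt (hA : ∀ f ∈ A, finrank F (range f) ≤ r)
    (hdim : finrank F A = finrank F G * r) (hEG : finrank F E < finrank F G)
    (hr : r ≤ finrank F E) :
    ∃ K : Submodule F E, finrank F K + r = finrank F E ∧ A = Submodule.compatibleMaps K ⊥ := by
  refine exists_eq_compatibleMaps_bot hA hdim hEG.le (hr.trans_lt hEG) fun g hg => ?_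
  refine ((isExtremal_map_transpose hA hdim).finrank_rankOneSpace_trichotomy (by simpa using hEG.le)
    (by simpa using hr) ?_).resolve_right fun h => hEG.ne (by simpa using h.1)
  simpa using mt (eval_apply_eq_zero_iff F g).1 hg

end Transpose

section Injective

variable {Q U : Type*} [AddCommGroup Q] [Module F Q] [AddCommGroup U] [Module F U]

theorem exists_linearEquiv_apply_eq {v w : U} (hv : v ≠ 0) (hw : w ≠ 0) :
    ∃ e : U ≃ₗ[F] U, e v = w := by
  obtain ⟨e, he⟩ := Submodule.exists_linearEquiv_restrict_eq
    ((LinearEquiv.toSpanNonzeroSingleton F U v hv).symm ≪≫ₗ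
      LinearEquiv.toSpanNonzeroSingleton F U w hw)
  refine ⟨e, ?_⟩
  rw [← he ⟨v, Submodule.mem_span_singleton_self v⟩, LinearEquiv.trans_apply,
    ← LinearEquiv.toSpanNonzeroSingleton_one F U v hv, LinearEquiv.symm_apply_apply,
    LinearEquiv.toSpanNonzeroSingleton_one]

variable [FiniteDimensional F Q] [FiniteDimensional F U]

theorem exists_injective_apply_eq (hQU : finrank F Q ≤ finrank F U) {u : Q} (hu : u ≠ 0) {w : U}
    (hw : w ≠ 0) : ∃ j : Q →ₗ[F] U, Function.Injective j ∧ j u = w := by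
  obtain ⟨j, hj⟩ : ∃ j : Q →ₗ[F] U, Function.Injective j := by
    rwa [← lift_rank_le_iff_exists_linearMap, ← finrank_eq_rank, ← finrank_eq_rank,
      Cardinal.lift_natCast, Cardinal.lift_natCast, Nat.cast_le]
  obtain ⟨e, he⟩ := exists_linearEquiv_apply_eq (F := F) (mt (map_eq_zero_iff j hj).1 hu) hw
  exact ⟨e ∘ₗ j, e.injective.comp hj, he⟩

theorem smulRight_mem_of_forall_injective_mem (hQU : finrank F Q ≤ finrank F U)
    {S : Submodule F (Q →ₗ[F] U)} (hS : ∀ j : Q →ₗ[F] U, Function.Injective j → j ∈ S)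
    (ψ : Dual F Q) {w : U} (hw : w ≠ 0) : ψ.smulRight w ∈ S := by
  by_cases hψ : ∃ u, u ≠ 0 ∧ ψ u = 0
  · obtain ⟨u, hu, hψu⟩ := hψ
    obtain ⟨j, hj, rfl⟩ := exists_injective_apply_eq hQU hu hw
    have hadd : j + ψ.smulRight (j u) = j ∘ₗ (LinearEquiv.transvection hψu).toLinearMap := by
      ext x
      simp [transvection.apply]
    refine (S.add_mem_iff_right (hS j hj)).1 (hS _ ?_)
    rw [hadd]
    exact hj.comp (LinearEquiv.transvection hψu).injective
  · refine hS _ ((injective_iff_map_eq_zero _).2 fun x hx => ?_)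
    by_contra hx0
    exact (smul_ne_zero (fun h => hψ ⟨x, hx0, h⟩) hw) hx

theorem eq_top_of_forall_injective_mem (hQU : finrank F Q ≤ finrank F U)
    {S : Submodule F (Q →ₗ[F] U)} (hS : ∀ j : Q →ₗ[F] U, Function.Injective j → j ∈ S) :
    S = ⊤ := by
  refine top_le_iff.1 (le_trans (fun f _ => mem_compatibleMaps_top.2 le_top)
    (compatibleMaps_top_le_iff.2 fun ψ w _ => ?_))
  rcases eq_or_ne w 0 with rfl | hw
  · exact Submodule.zero_mem _
  · exact smulRight_mem_of_forall_injective_mem hQU hS ψ hw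

end Injective

section Square

variable {A : Submodule F (E →ₗ[F] G)} {r : ℕ}

theorem exists_eq_smulRight_of_ker_le {φ : Dual F E} {f : E →ₗ[F] G} (hφ : φ ≠ 0)
    (h : ker φ ≤ ker f) : ∃ g, f = φ.smulRight g := by
  obtain ⟨y, hy⟩ := φ.surjective hφ 1
  refine ⟨f y, LinearMap.ext fun x => sub_eq_zero.1 ?_⟩
  have hx : x - φ x • y ∈ ker φ := by simp [hy]
  simpa using h hx

theorem exists_eq_smulRight_of_range_le {f : E →ₗ[F] G} {g : G} (hg : g ≠ 0)
    (h : range f ≤ Submodule.span F {g}) : ∃ φ : Dual F E, f = φ.smulRight g :=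
  ⟨LinearEquiv.coord F G g hg ∘ₗ f.codRestrict _ fun x => h ⟨x, rfl⟩, LinearMap.ext fun _ =>
    (LinearEquiv.coord_apply_smul F G g hg ⟨f _, h ⟨_, rfl⟩⟩).symm⟩

theorem inf_ker_domRestrict_eq_bot {φ : Dual F E} (hφ : φ ≠ 0) (hbot : rankOneSpace A φ = ⊥) :
    A ⊓ ker (domRestrict' (M₂ := G) (ker φ)) = ⊥ := by
  refine (Submodule.eq_bot_iff _).2 fun f ⟨hf, hf_res⟩ => ?_
  obtain ⟨g, rfl⟩ := exists_eq_smulRight_of_ker_le hφ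
    fun x hx => LinearMap.congr_fun (mem_ker.1 hf_res) ⟨x, hx⟩
  obtain rfl : g = 0 := (Submodule.eq_bot_iff _).1 hbot g hf
  exact smulRight_zero φ

theorem range_domRestrict_le (f : E →ₗ[F] G) (H : Submodule F E) :
    range (f.domRestrict H) ≤ range f :=
  range_comp_le_range _ _

variable [FiniteDimensional F E] [FiniteDimensional F G]

theorem IsExtremal.exists_map_domRestrict_eq (hA : IsExtremal A r)
    (hGE : finrank F G = finrank F E) (hr : r < finrank F G) {φ : Dual F E} (hφ : φ ≠ 0)
    (hbot : rankOneSpace A φ = ⊥) :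
    ∃ K : Submodule F (ker φ), finrank F K + r = finrank F (ker φ) ∧
      A.map (domRestrict' (ker φ)) = Submodule.compatibleMaps K ⊥ := by
  have hker := Dual.finrank_ker_add_one_of_ne_zero hφ
  refine exists_eq_compatibleMaps_bot_of_finrank_lt ?_ ?_ (by omega) (by omega)
  · rintro _ ⟨f, hf, rfl⟩
    exact (Submodule.finrank_mono (range_domRestrict_le f _)).trans (hA.finrank_range_le f hf)
  · rw [hGE, ← hA.finrank_eq, ← finrank_map_add_finrank_inf_ker (domRestrict' (ker φ)) A,
      inf_ker_domRestrict_eq_bot hφ hbot, finrank_bot, add_zero]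

/-- The maps `H → U` that extend to maps `E → U` in `A` form a subspace, which contains those of
rank `r`: their extensions in `A` have the same range, since their rank is at most `r` as well. -/
theorem inf_compatibleMaps_le {H : Submodule F E} {K : Submodule F H}
    (hA : ∀ f ∈ A, finrank F (range f) ≤ r) (hK : finrank F K + r = finrank F H)
    (hAK : A.map (domRestrict' H) = Submodule.compatibleMaps K ⊥)
    (hinj : A ⊓ ker (domRestrict' H) = ⊥) {U : Submodule F G} (hU : r ≤ finrank F U) :
    A ⊓ Submodule.compatibleMaps H U ≤ Submodule.compatibleMaps ⊤ U := by
  let extend : ((H ⧸ K) →ₗ[F] U) →ₗ[F] (H →ₗ[F] G) := lcomp F G K.mkQ ∘ₗ U.subtype.compRight F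
  have hrQ : finrank F (H ⧸ K) = r := by have := K.finrank_quotient_add_finrank; omega
  have htop : ((A ⊓ Submodule.compatibleMaps ⊤ U).map (domRestrict' H)).comap extend = ⊤ := by
    refine eq_top_of_forall_injective_mem (hrQ.trans_le hU) fun j hj => ?_
    obtain ⟨f, hf, hfj⟩ : extend j ∈ A.map (domRestrict' H) := by
      rw [hAK]
      intro x hx
      simp [extend, (Submodule.Quotient.mk_eq_zero K).2 hx]
    have hrange : range (f.domRestrict H) = range (U.subtype ∘ₗ j) := by
      change range (domRestrict' H f) = _
      rw [hfj]
      exact range_comp_of_range_eq_top (U.subtype ∘ₗ j) K.range_mkQ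
    have hfinrank : finrank F (range (f.domRestrict H)) = r := by
      rw [hrange, finrank_range_of_inj (Subtype.val_injective.comp hj), hrQ]
    have heq := Submodule.eq_of_le_of_finrank_le (range_domRestrict_le f H)
      (hfinrank ▸ hA f hf)
    refine ⟨f, ⟨hf, mem_compatibleMaps_top.2 ?_⟩, hfj⟩
    rw [← heq, hrange]
    exact (range_comp_le_range _ _).trans U.range_subtype.le
  rintro f ⟨hf, hfU⟩
  have hfK : f.domRestrict H ∈ Submodule.compatibleMaps K ⊥ := hAK ▸ ⟨f, hf, rfl⟩
  obtain ⟨f', ⟨hf', hf'U⟩, hff'⟩ : K.liftQ ((f.domRestrict H).codRestrict U fun x => hfU x.2)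
      (fun x hx => Subtype.ext (hfK hx)) ∈ _ := htop ▸ Submodule.mem_top
  have hsub : f' - f ∈ A ⊓ ker (domRestrict' H) :=
    ⟨A.sub_mem hf' hf, sub_mem_ker_iff.2 hff'⟩
  rw [hinj, Submodule.mem_bot, sub_eq_zero] at hsub
  exact hsub ▸ hf'U

theorem IsExtremal.rankOneSpace_map_transpose_ne_bot (hA : IsExtremal A r)
    (hGE : finrank F G = finrank F E) (hr0 : 0 < r) (hr : r < finrank F G) {φ : Dual F E}
    (hφ : φ ≠ 0) (hbot : rankOneSpace A φ = ⊥) {g : G} (hg : g ≠ 0) :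
    rankOneSpace (A.map Dual.transpose) (Dual.eval F G g) ≠ ⊥ := by
  obtain ⟨K, hK, hAK⟩ := hA.exists_map_domRestrict_eq hGE hr hφ hbot
  obtain ⟨ψ, hψ, hKψ⟩ := Submodule.exists_le_ker_of_lt_top K
    (Submodule.lt_top_of_finrank_lt_finrank (by omega))
  obtain ⟨f, hf, hfψ⟩ : ψ.smulRight g ∈ A.map (domRestrict' (ker φ)) := by
    rw [hAK]
    intro x hx
    simp [mem_ker.1 (hKψ hx)]
  have hfψ_apply (x : ker φ) : f x = ψ x • g := LinearMap.congr_fun hfψ x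
  have hrange : range f ≤ Submodule.span F {g} := by
    intro w hwf
    by_contra hw
    obtain ⟨χ, hχw, hχ⟩ := Submodule.exists_le_ker_of_notMem hw
    have hker := Dual.finrank_ker_add_one_of_ne_zero (f := χ) (by rintro rfl; exact hχw rfl)
    refine hχw (mem_compatibleMaps_top.1 (inf_compatibleMaps_le hA.finrank_range_le hK hAK
      (inf_ker_domRestrict_eq_bot hφ hbot) (U := ker χ) (by omega) ⟨hf, fun x hx => ?_⟩) hwf)
    change f (⟨x, hx⟩ : ker φ) ∈ ker χ
    rw [hfψ_apply]
    exact (ker χ).smul_mem _ (hχ (Submodule.mem_span_singleton_self g))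
  obtain ⟨φ', rfl⟩ := exists_eq_smulRight_of_range_le hg hrange
  refine (Submodule.ne_bot_iff _).2 ⟨φ', mem_rankOneSpace_map_transpose.2 hf, ?_⟩
  rintro rfl
  refine hψ (LinearMap.ext fun x => (smul_eq_zero.1 ?_).resolve_right hg)
  rw [← hfψ_apply, smulRight_apply, LinearMap.zero_apply, zero_smul]

theorem IsExtremal.rankOneSpace_map_transpose_ne_top (hA : IsExtremal A r)
    (hGE : finrank F G ≤ finrank F E) (hr : r < finrank F G) {φ : Dual F E} (hφ : φ ≠ 0)
    (htop : rankOneSpace A φ = ⊤) {g : G} (hg : g ≠ 0) :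
    rankOneSpace (A.map Dual.transpose) (Dual.eval F G g) ≠ ⊤ := by
  intro htop'
  obtain ⟨k, b, rfl⟩ := exists_basis_coord_zero_eq hφ
  rcases hA.finrank_leadingSpace_dichotomy hGE hr.le b with h | ⟨-, h⟩
  · have h0 := h 0
    rw [leadingSpace_zero, htop, finrank_top] at h0
    exact hr.ne' h0
  · have hne (j) : leadingSpace A b j ≠ ⊥ := (Submodule.ne_bot_iff _).2
      ⟨g, rankOneSpace_coord_le_leadingSpace b j
        (mem_rankOneSpace_map_transpose.1 (htop' ▸ Submodule.mem_top)), hg⟩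
    have hfull (j) : finrank F (leadingSpace A b j) = finrank F G :=
      (h j).resolve_left (mt Submodule.finrank_eq_zero.1 (hne j))
    have hsum := sum_finrank_leadingSpace A b
    rw [hA.finrank_eq, Finset.sum_congr rfl fun j _ => hfull j, Finset.sum_const, Finset.card_univ,
      smul_eq_mul, ← finrank_eq_card_basis b] at hsum
    exact hr.ne' (Nat.eq_of_mul_eq_mul_left (by omega) hsum)

theorem IsExtremal.eq_compatibleMaps_top_or_bot (hA : IsExtremal A r)
    (hGE : finrank F G ≤ finrank F E) :
    (∃ V : Submodule F G, A = Submodule.compatibleMaps ⊤ V) ∨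
      (finrank F G = finrank F E ∧ ∃ K : Submodule F E, A = Submodule.compatibleMaps K ⊥) := by
  rcases le_or_gt (finrank F G) r with hr | hr
  · have hA_top : A = ⊤ := Submodule.eq_top_of_finrank_eq (le_antisymm (Submodule.finrank_le A) (by
      rw [finrank_linearMap, hA.finrank_eq]
      exact Nat.mul_le_mul_left _ hr))
    exact Or.inl ⟨⊤, hA_top.trans (top_le_iff.1 fun f _ => mem_compatibleMaps_top.2 le_top).symm⟩
  by_cases h : ∀ φ : Dual F E, φ ≠ 0 → finrank F (rankOneSpace A φ) = r
  · obtain ⟨V, -, hV⟩ := hA.exists_eq_compatibleMaps_top hGE (hr.trans_le hGE) h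
    exact Or.inl ⟨V, hV⟩
  push Not at h
  obtain ⟨φ, hφ, hφr⟩ := h
  obtain ⟨heq, hφ'⟩ := (hA.finrank_rankOneSpace_trichotomy hGE hr.le hφ).resolve_left hφr
  have hdim : finrank F A = finrank F G * r := by rw [hA.finrank_eq, heq]
  have hdual (g : G) (hg : g ≠ 0) :
      finrank F (rankOneSpace (A.map Dual.transpose) (Dual.eval F G g)) = r := by
    refine ((isExtremal_map_transpose hA.finrank_range_le hdim).finrank_rankOneSpace_trichotomy
      (by simp [heq]) (by simpa using heq ▸ hr.le)
      (mt (eval_apply_eq_zero_iff F g).1 hg)).resolve_right fun ⟨_, h⟩ => ?_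
    rcases hφ' with hbot | htop
    · have hr0 : 0 < r := Nat.pos_of_ne_zero fun h0 => hφr (by rw [hbot, finrank_bot, h0])
      refine h.elim (hA.rankOneSpace_map_transpose_ne_bot heq hr0 hr hφ hbot hg) fun htop' => hg ?_
      rw [← Submodule.mem_bot F, ← hbot, ← mem_rankOneSpace_map_transpose, htop']
      exact Submodule.mem_top
    · refine h.elim (fun hbot' => hφ ?_) (hA.rankOneSpace_map_transpose_ne_top hGE hr hφ htop hg)
      rw [← Submodule.mem_bot F, ← hbot', mem_rankOneSpace_map_transpose, htop]
      exact Submodule.mem_top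
  obtain ⟨K, -, hK⟩ := exists_eq_compatibleMaps_bot hA.finrank_range_le hdim heq.ge hr hdual
  exact Or.inr ⟨heq, K, hK⟩

end Square

end RankMetric

namespace QPolymatroid

variable {F E : Type*} [Field F] [AddCommGroup E] [Module F E] [FiniteDimensional F E]

theorem isGreatest_flatDims {M : QPolymatroid F E} {t : ℚ} {d : ℕ}
    (h : IsGreatest {d | ∃ V, M.rho V ≤ M.rho ⊤ - t ∧ Module.finrank F V = d} d) :
    IsGreatest (M.flatDims t) d := by
  obtain ⟨⟨V, hV, rfl⟩, hmax⟩ := h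
  refine ⟨⟨V, fun x hx => ?_, hV, rfl⟩, fun _ ⟨W, _, hW⟩ => hmax ⟨W, hW⟩⟩
  by_contra! hle
  exact (Submodule.finrank_lt_finrank_of_lt (Submodule.lt_sup_iff_notMem.2 hx)).not_ge
    (hmax ⟨_, hle.trans hV, rfl⟩)

end QPolymatroid

namespace RankMetric

open Module Matrix

variable {F : Type*} [Field F] {n m : ℕ}

section Perp

variable {l : ℕ}

theorem nondegenerate_dotProductBilin :
    (dotProductBilin F F : LinearMap.BilinForm F (Fin l → F)).Nondegenerate :=
  ⟨dotProduct_eq_zero, fun w hw => dotProduct_eq_zero w fun v => (dotProduct_comm w v).trans (hw v)⟩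

theorem finrank_perp (V : Submodule F (Fin l → F)) : finrank F (perp V) = l - finrank F V := by
  have h := LinearMap.BilinForm.finrank_orthogonal nondegenerate_dotProductBilin V
  rwa [finrank_fin_fun] at h

theorem perp_perp (V : Submodule F (Fin l → F)) : perp (perp V) = V :=
  LinearMap.BilinForm.orthogonal_orthogonal (B := dotProductBilin F F)
    nondegenerate_dotProductBilin (fun v w h => (dotProduct_comm w v).trans h) V

theorem perp_top : perp (⊤ : Submodule F (Fin l → F)) = ⊥ :=
  (Submodule.eq_bot_iff _).2 fun w hw =>
    dotProduct_eq_zero w fun v => (dotProduct_comm w v).trans (hw v trivial)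

end Perp

section TransposeCode

/-- The code of the transposes of the matrices in `C`, which exchanges the roles of columns and
rows. -/
def transposeCode (C : Submodule F (Matrix (Fin n) (Fin m) F)) :
    Submodule F (Matrix (Fin m) (Fin n) F) :=
  C.map (transposeLinearEquiv (Fin n) (Fin m) F F).toLinearMap

theorem mem_transposeCode {C : Submodule F (Matrix (Fin n) (Fin m) F)}
    {M : Matrix (Fin m) (Fin n) F} : M ∈ transposeCode C ↔ Mᵀ ∈ C :=
  Submodule.mem_map_equiv C

theorem transposeCode_transposeCode (C : Submodule F (Matrix (Fin n) (Fin m) F)) :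
    transposeCode (transposeCode C) = C := by
  ext M
  rw [mem_transposeCode, mem_transposeCode, transpose_transpose]

theorem finrank_transposeCode (C : Submodule F (Matrix (Fin n) (Fin m) F)) :
    finrank F (transposeCode C) = finrank F C :=
  LinearEquiv.finrank_map_eq _ C

theorem shortenCol_transposeCode (C : Submodule F (Matrix (Fin n) (Fin m) F))
    (W : Submodule F (Fin m → F)) :
    shortenCol (transposeCode C) W = transposeCode (shortenRow C W) := by
  ext M
  rw [mem_transposeCode]
  exact and_congr mem_transposeCode Iff.rfl

theorem finrank_shortenCol_transposeCode (C : Submodule F (Matrix (Fin n) (Fin m) F))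
    (W : Submodule F (Fin m → F)) :
    finrank F (shortenCol (transposeCode C) W) = finrank F (shortenRow C W) := by
  rw [shortenCol_transposeCode, finrank_transposeCode]

theorem rowPM_eq_colPM_transposeCode (C : Submodule F (Matrix (Fin n) (Fin m) F)) :
    rowPM C = colPM (transposeCode C) := by
  simp only [rowPM, colPM, finrank_shortenCol_transposeCode, finrank_transposeCode]

theorem flatWeightRow_eq_flatWeightCol_transposeCode
    (C : Submodule F (Matrix (Fin n) (Fin m) F)) (i : ℕ) :
    flatWeightRow C i = flatWeightCol (transposeCode C) i := by
  rw [flatWeightRow, flatWeightCol, rowPM_eq_colPM_transposeCode]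

theorem maxrk_transposeCode (C : Submodule F (Matrix (Fin n) (Fin m) F)) :
    maxrk (transposeCode C) = maxrk C := by
  refine congrArg sSup (Set.ext fun r => ⟨fun ⟨M, hM, hr⟩ => ?_, fun ⟨M, hM, hr⟩ => ?_⟩)
  · exact ⟨Mᵀ, mem_transposeCode.1 hM, M.rank_transpose.trans hr⟩
  · exact ⟨Mᵀ, mem_transposeCode.2 hM, M.rank_transpose.trans hr⟩

end TransposeCode

section ColWeight

variable {C : Submodule F (Matrix (Fin n) (Fin m) F)} {i : ℕ}

/-- The dimensions of the subspaces of `F^n` that contain the column spaces of all the matrices in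
some subcode of `C` of dimension at least `i`. -/
def colSupportDims (C : Submodule F (Matrix (Fin n) (Fin m) F)) (i : ℕ) : Set ℕ :=
  {d | ∃ U : Submodule F (Fin n → F), i ≤ finrank F (shortenCol C U) ∧ finrank F U = d}

/-- The least dimension of a space containing the column spaces of an `i`-dimensional subcode. -/
noncomputable def colWeight (C : Submodule F (Matrix (Fin n) (Fin m) F)) (i : ℕ) : ℕ :=
  sInf (colSupportDims C i)

theorem shortenCol_top (C : Submodule F (Matrix (Fin n) (Fin m) F)) : shortenCol C ⊤ = C :=
  Submodule.ext fun _ => and_iff_left le_top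

theorem shortenCol_bot (C : Submodule F (Matrix (Fin n) (Fin m) F)) : shortenCol C ⊥ = ⊥ :=
  (Submodule.eq_bot_iff _).2 fun _ hM =>
    Matrix.ext fun k j => congrFun ((colsp_le_iff _ _).1 hM.2 j) k

theorem pos_rows_of_ne_bot (hC : C ≠ ⊥) : 0 < n := by
  refine Nat.pos_of_ne_zero fun hn => hC ?_
  subst hn
  exact Subsingleton.elim _ _

theorem isLeast_colWeight (hi : i ≤ finrank F C) : IsLeast (colSupportDims C i) (colWeight C i) :=
  isLeast_csInf ⟨_, ⊤, by rwa [shortenCol_top], rfl⟩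

theorem colPM_rho_le_iff (hm : 0 < m) (V : Submodule F (Fin n → F)) :
    (colPM C).rho V ≤ (colPM C).rho ⊤ - i / m ↔ i ≤ finrank F (shortenCol C (perp V)) := by
  have hm' : (0 : ℚ) < m := Nat.cast_pos.2 hm
  have htop : finrank F (shortenCol C (perp ⊤)) = 0 := by
    rw [perp_top, shortenCol_bot, finrank_bot]
  simp only [colPM, htop, ← sub_div, Nat.cast_zero, sub_zero]
  rw [div_le_div_iff_of_pos_right hm', sub_le_sub_iff_left, Nat.cast_le]

theorem isGreatest_flatDims_colPM (hm : 0 < m) (hi : i ≤ finrank F C) :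
    IsGreatest ((colPM C).flatDims (i / m)) (n - colWeight C i) := by
  obtain ⟨⟨U, hU, hUw⟩, hmin⟩ := isLeast_colWeight hi
  refine QPolymatroid.isGreatest_flatDims ⟨⟨perp U, ?_, by rw [finrank_perp, hUw]⟩, ?_⟩
  · rwa [colPM_rho_le_iff hm, perp_perp]
  · rintro _ ⟨V, hV, rfl⟩
    have hle := hmin ⟨perp V, (colPM_rho_le_iff hm V).1 hV, rfl⟩
    have hV_dim := Submodule.finrank_le V
    rw [finrank_fin_fun] at hV_dim
    rw [finrank_perp] at hle
    omega

theorem flatWeightCol_eq_colWeight (hm : 0 < m) (hi : i ≤ finrank F C) :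
    flatWeightCol C i = colWeight C i := by
  obtain ⟨⟨U, -, hU⟩, -⟩ := isLeast_colWeight hi
  have hle : colWeight C i ≤ n := by
    simpa only [hU, finrank_fin_fun] using U.finrank_le
  rw [flatWeightCol, (isGreatest_flatDims_colPM hm hi).csSup_eq, Nat.cast_sub hle, sub_sub_cancel]

theorem colWeight_transposeCode_one_le (hC : C ≠ ⊥) :
    colWeight (transposeCode C) 1 ≤ colWeight C 1 := by
  have hC_pos : 1 ≤ finrank F C := Submodule.one_le_finrank_iff.2 hC
  obtain ⟨⟨U, hU, hUw⟩, -⟩ := isLeast_colWeight hC_pos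
  obtain ⟨M, hM, hM0⟩ := (Submodule.ne_bot_iff _).1 (Submodule.one_le_finrank_iff.1 hU)
  have hrow : 1 ≤ finrank F (shortenCol (transposeCode C) (rowsp M)) := by
    rw [finrank_shortenCol_transposeCode, Submodule.one_le_finrank_iff, Submodule.ne_bot_iff]
    exact ⟨M, ⟨hM.1, le_rfl⟩, hM0⟩
  calc colWeight (transposeCode C) 1 ≤ finrank F (rowsp M) := Nat.sInf_le ⟨_, hrow, rfl⟩
    _ = M.rank := M.rank_eq_finrank_span_row.symm
    _ = finrank F (colsp M) := M.rank_eq_finrank_span_cols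
    _ ≤ finrank F U := Submodule.finrank_mono hM.2
    _ = colWeight C 1 := hUw

theorem colWeight_transposeCode_one (hC : C ≠ ⊥) :
    colWeight (transposeCode C) 1 = colWeight C 1 := by
  refine le_antisymm (colWeight_transposeCode_one_le hC) ?_
  have hCt : transposeCode C ≠ ⊥ := by
    rwa [← Submodule.one_le_finrank_iff, finrank_transposeCode, Submodule.one_le_finrank_iff]
  simpa only [transposeCode_transposeCode] using colWeight_transposeCode_one_le hCt

end ColWeight

section OptimalAnticode

variable {A : Submodule F (Matrix (Fin n) (Fin m) F)}

theorem rank_le_maxrk {M : Matrix (Fin n) (Fin m) F} (hM : M ∈ A) : M.rank ≤ maxrk A :=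
  le_csSup ⟨n, fun _ ⟨M, _, hr⟩ => hr ▸ M.rank_le_height⟩ ⟨M, hM, rfl⟩

theorem finrank_range_le_maxrk :
    ∀ f ∈ A.map toLin'.toLinearMap, finrank F (LinearMap.range f) ≤ maxrk A := by
  rintro _ ⟨M, hM, rfl⟩
  exact rank_le_maxrk hM

theorem finrank_map_toLin' : finrank F (A.map toLin'.toLinearMap) = finrank F A :=
  LinearEquiv.finrank_map_eq toLin' A

theorem finrank_le_mul_maxrk (hnm : n ≤ m) : finrank F A ≤ m * maxrk A := by
  have h := finrank_le_mul_of_finrank_range_le (by simpa using hnm)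
    (finrank_range_le_maxrk (A := A))
  rwa [finrank_map_toLin', finrank_fin_fun] at h

theorem IsOptimalAnticode.isExtremal (hA : IsOptimalAnticode A) :
    IsExtremal (A.map toLin'.toLinearMap) (maxrk A) where
  finrank_range_le := finrank_range_le_maxrk
  finrank_eq := by rw [finrank_map_toLin', hA, finrank_fin_fun]

theorem map_toLin'_shortenCol_top (V : Submodule F (Fin n → F)) :
    (shortenCol (⊤ : Submodule F (Matrix (Fin n) (Fin m) F)) V).map toLin'.toLinearMap =
      Submodule.compatibleMaps ⊤ V := by
  ext f
  obtain ⟨M, rfl⟩ := toLin'.surjective f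
  rw [mem_compatibleMaps_top]
  refine (toLin'.injective.mem_set_image (a := M)).trans
    ((and_iff_right Submodule.mem_top).trans ?_)
  rw [colsp, ← range_mulVecLin, toLin'_apply']

theorem map_toLin'_shortenRow_top_perp (K : Submodule F (Fin m → F)) :
    (shortenRow (⊤ : Submodule F (Matrix (Fin n) (Fin m) F)) (perp K)).map toLin'.toLinearMap =
      Submodule.compatibleMaps K ⊥ := by
  ext f
  obtain ⟨M, rfl⟩ := toLin'.surjective f
  refine (toLin'.injective.mem_set_image (a := M)).trans
    ((and_iff_right Submodule.mem_top).trans ?_)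
  rw [rowsp_le_iff]
  exact ⟨fun h v hv => funext fun i => (dotProduct_comm _ _).trans (h i v hv),
    fun h i v hv => (dotProduct_comm _ _).trans (congrFun (h hv) i)⟩

theorem IsOptimalAnticode.eq_shorten (hnm : n ≤ m) (hA : IsOptimalAnticode A) :
    (∃ V, A = shortenCol ⊤ V) ∨ (n = m ∧ ∃ W, A = shortenRow ⊤ W) := by
  have hinj := Submodule.map_injective_of_injective (f := toLin'.toLinearMap)
    (toLin' (R := F) (m := Fin n) (n := Fin m)).injective
  rcases hA.isExtremal.eq_compatibleMaps_top_or_bot (by simpa using hnm) with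
    ⟨V, hV⟩ | ⟨hnm', K, hK⟩
  · exact Or.inl ⟨V, hinj (hV.trans (map_toLin'_shortenCol_top V).symm)⟩
  · exact Or.inr ⟨by simpa using hnm', perp K,
      hinj (hK.trans (map_toLin'_shortenRow_top_perp K).symm)⟩

theorem finrank_shortenCol_top (V : Submodule F (Fin n → F)) :
    finrank F (shortenCol (⊤ : Submodule F (Matrix (Fin n) (Fin m) F)) V) = m * finrank F V := by
  rw [← finrank_map_toLin', map_toLin'_shortenCol_top, finrank_compatibleMaps_top, finrank_fin_fun]

theorem isOptimalAnticode_shortenCol_top (hnm : n ≤ m) (V : Submodule F (Fin n → F)) :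
    IsOptimalAnticode (shortenCol (⊤ : Submodule F (Matrix (Fin n) (Fin m) F)) V) := by
  refine le_antisymm (finrank_le_mul_maxrk hnm) ?_
  rw [finrank_shortenCol_top]
  refine Nat.mul_le_mul_left m (csSup_le' ?_)
  rintro _ ⟨M, hM, rfl⟩
  rw [rank_eq_finrank_span_cols]
  exact Submodule.finrank_mono hM.2

theorem isOptimalAnticode_transposeCode_iff {A : Submodule F (Matrix (Fin n) (Fin n) F)} :
    IsOptimalAnticode (transposeCode A) ↔ IsOptimalAnticode A := by
  rw [IsOptimalAnticode, finrank_transposeCode, maxrk_transposeCode, IsOptimalAnticode]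

theorem transposeCode_shortenRow_top (W : Submodule F (Fin m → F)) :
    transposeCode (shortenRow (⊤ : Submodule F (Matrix (Fin n) (Fin m) F)) W) =
      shortenCol ⊤ W := by
  ext M
  rw [mem_transposeCode]
  exact Iff.rfl

theorem finrank_shortenRow_top (W : Submodule F (Fin m → F)) :
    finrank F (shortenRow (⊤ : Submodule F (Matrix (Fin n) (Fin m) F)) W) = n * finrank F W := by
  rw [← finrank_transposeCode, transposeCode_shortenRow_top, finrank_shortenCol_top]

theorem isOptimalAnticode_shortenRow_top (W : Submodule F (Fin n → F)) :
    IsOptimalAnticode (shortenRow (⊤ : Submodule F (Matrix (Fin n) (Fin n) F)) W) := by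
  rw [← isOptimalAnticode_transposeCode_iff, transposeCode_shortenRow_top]
  exact isOptimalAnticode_shortenCol_top le_rfl W

theorem isOptimalAnticode_iff (hnm : n ≤ m) : IsOptimalAnticode A ↔
    (∃ V, A = shortenCol ⊤ V) ∨ (n = m ∧ ∃ W, A = shortenRow ⊤ W) := by
  refine ⟨fun hA => hA.eq_shorten hnm, ?_⟩
  rintro (⟨V, rfl⟩ | ⟨rfl, W, rfl⟩)
  · exact isOptimalAnticode_shortenCol_top hnm V
  · exact isOptimalAnticode_shortenRow_top W

end OptimalAnticode

section GenWeight

variable {C : Submodule F (Matrix (Fin n) (Fin m) F)} {i : ℕ}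

theorem inf_shortenCol_top (C : Submodule F (Matrix (Fin n) (Fin m) F))
    (V : Submodule F (Fin n → F)) : C ⊓ shortenCol ⊤ V = shortenCol C V :=
  Submodule.ext fun _ => and_congr_right fun _ => and_iff_right trivial

theorem inf_shortenRow_top (C : Submodule F (Matrix (Fin n) (Fin m) F))
    (W : Submodule F (Fin m → F)) : C ⊓ shortenRow ⊤ W = shortenRow C W :=
  Submodule.ext fun _ => and_congr_right fun _ => and_iff_right trivial

theorem anticodeDims_of_lt (hnm : n < m) (C : Submodule F (Matrix (Fin n) (Fin m) F)) (i : ℕ) :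
    anticodeDims C i = (m * ·) '' colSupportDims C i := by
  ext d
  simp only [anticodeDims, isOptimalAnticode_iff hnm.le, hnm.ne, false_and, or_false]
  constructor
  · rintro ⟨_, ⟨V, rfl⟩, hV, rfl⟩
    exact ⟨_, ⟨V, inf_shortenCol_top C V ▸ hV, rfl⟩, (finrank_shortenCol_top V).symm⟩
  · rintro ⟨_, ⟨V, hV, rfl⟩, rfl⟩
    exact ⟨_, ⟨V, rfl⟩, inf_shortenCol_top C V ▸ hV, finrank_shortenCol_top V⟩

theorem anticodeDims_square (C : Submodule F (Matrix (Fin n) (Fin n) F)) (i : ℕ) :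
    anticodeDims C i = (n * ·) '' (colSupportDims C i ∪ colSupportDims (transposeCode C) i) := by
  ext d
  simp only [anticodeDims, isOptimalAnticode_iff le_rfl, true_and]
  constructor
  · rintro ⟨_, ⟨V, rfl⟩ | ⟨W, rfl⟩, hi, rfl⟩
    · exact ⟨_, Or.inl ⟨V, inf_shortenCol_top C V ▸ hi, rfl⟩, (finrank_shortenCol_top V).symm⟩
    · rw [inf_shortenRow_top, ← finrank_shortenCol_transposeCode] at hi
      exact ⟨_, Or.inr ⟨W, hi, rfl⟩, (finrank_shortenRow_top W).symm⟩
  · rintro ⟨_, ⟨V, hi, rfl⟩ | ⟨W, hi, rfl⟩, rfl⟩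
    · exact ⟨_, Or.inl ⟨V, rfl⟩, inf_shortenCol_top C V ▸ hi, finrank_shortenCol_top V⟩
    · rw [finrank_shortenCol_transposeCode, ← inf_shortenRow_top] at hi
      exact ⟨_, Or.inr ⟨W, rfl⟩, hi, finrank_shortenRow_top W⟩

theorem isLeast_anticodeDims_of_lt (hnm : n < m) (hi : i ≤ finrank F C) :
    IsLeast (anticodeDims C i) (m * colWeight C i) := by
  rw [anticodeDims_of_lt hnm]
  exact mul_right_mono.map_isLeast (isLeast_colWeight hi)

theorem isLeast_anticodeDims_square {C : Submodule F (Matrix (Fin n) (Fin n) F)}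
    (hi : i ≤ finrank F C) :
    IsLeast (anticodeDims C i) (n * min (colWeight C i) (colWeight (transposeCode C) i)) := by
  rw [anticodeDims_square]
  exact mul_right_mono.map_isLeast
    ((isLeast_colWeight hi).union (isLeast_colWeight (hi.trans_eq (finrank_transposeCode C).symm)))

theorem nonempty_anticodeDims (hnm : n ≤ m) (hi : i ≤ finrank F C) :
    (anticodeDims C i).Nonempty := by
  obtain hlt | rfl := hnm.lt_or_eq
  · exact (isLeast_anticodeDims_of_lt hlt hi).nonempty
  · exact (isLeast_anticodeDims_square hi).nonempty

theorem genWeight_eq_of_isLeast (hm : 0 < m) {w : ℕ} (hw : IsLeast (anticodeDims C i) (m * w)) :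
    genWeight C i = w := by
  rw [genWeight, hw.csInf_eq, Nat.cast_mul, one_div,
    inv_mul_cancel_left₀ (Nat.cast_ne_zero.2 hm.ne')]

end GenWeight

end RankMetric

open RankMetric in
theorem mainTheorem7_general {F : Type*} [Field F] {n m : ℕ} (hnm : n ≤ m)
    (C : Submodule F (Matrix (Fin n) (Fin m) F)) (hC : C ≠ ⊥) :
    (∀ i : ℕ, i ≤ Module.finrank F C →
      (anticodeDims C i).Nonempty ∧
      ((colPM C).flatDims ((i : ℚ) / m)).Nonempty ∧
      ((rowPM C).flatDims ((i : ℚ) / n)).Nonempty ∧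
      (n < m → genWeight C i = flatWeightCol C i) ∧
      (n = m → genWeight C i = min (flatWeightCol C i) (flatWeightRow C i))) ∧
    flatWeightCol C 1 = flatWeightRow C 1 := by
  have hn : 0 < n := pos_rows_of_ne_bot hC
  have hm : 0 < m := hn.trans_le hnm
  have hcol {i : ℕ} (hi : i ≤ Module.finrank F C) : flatWeightCol C i = colWeight C i :=
    flatWeightCol_eq_colWeight hm hi
  have hrow {i : ℕ} (hi : i ≤ Module.finrank F C) :
      flatWeightRow C i = colWeight (transposeCode C) i := by
    rw [flatWeightRow_eq_flatWeightCol_transposeCode]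
    exact flatWeightCol_eq_colWeight hn (by rwa [finrank_transposeCode])
  refine ⟨fun i hi => ⟨nonempty_anticodeDims hnm hi, (isGreatest_flatDims_colPM hm hi).nonempty,
    ?_, fun hlt => ?_, ?_⟩, ?_⟩
  · rw [rowPM_eq_colPM_transposeCode]
    exact (isGreatest_flatDims_colPM hn (by rwa [finrank_transposeCode])).nonempty
  · rw [hcol hi, genWeight_eq_of_isLeast hm (isLeast_anticodeDims_of_lt hlt hi)]
  · rintro rfl
    rw [hcol hi, hrow hi, genWeight_eq_of_isLeast hm (isLeast_anticodeDims_square hi), Nat.cast_min]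
  · have h1 : 1 ≤ Module.finrank F C := Submodule.one_le_finrank_iff.2 hC
    rw [hcol h1, hrow h1, colWeight_transposeCode_one hC]

/-- The three nonemptiness clauses say that the minimum and the maxima that define the weights
are taken over nonempty (and clearly bounded) sets of dimensions. -/
theorem mainTheorem7 {F : Type*} [Field F] [Finite F] {n m : ℕ} (hnm : n ≤ m)
    (C : Submodule F (Matrix (Fin n) (Fin m) F)) (hC : C ≠ ⊥) :
    (∀ i : ℕ, 1 ≤ i → i ≤ Module.finrank F C →
      (RankMetric.anticodeDims C i).Nonempty ∧
      ((RankMetric.colPM C).flatDims ((i : ℚ) / m)).Nonempty ∧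
      ((RankMetric.rowPM C).flatDims ((i : ℚ) / n)).Nonempty ∧
      (n < m → RankMetric.genWeight C i = RankMetric.flatWeightCol C i) ∧
      (n = m → RankMetric.genWeight C i =
        min (RankMetric.flatWeightCol C i) (RankMetric.flatWeightRow C i))) ∧
    (n = m → RankMetric.flatWeightCol C 1 = RankMetric.flatWeightRow C 1) :=
  have ⟨hweights, hone⟩ := mainTheorem7_general hnm C hC
  ⟨fun i _ => hweights i, fun _ => hone⟩
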